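/- Let $E$ be a finite set. An interval greedoid is a pair $(E,\mathcal F)$ with $\mathcal F$ a nonempty family of subsets of $E$ (the feasible sets) such that for all $X,Y,Z\in\mathcal F$: (IG1) if $X\ne\emptyset$, then $X\setminus\{x\}\in\mathcal F$ for some $x\in X$; (IG2) if $|X|>|Y|$, then $Y\cup\{x\}\in\mathcal F$ for some $x\in X\setminus Y$; (IG3) if $X\subseteq Y\subseteq Z$, $e\in E\setminus Z$ and $X\cup\{e\},Z\cup\{e\}\in\mathcal F$, then $Y\cup\{e\}\in\mathcal F$. For $X\in\mathcal F$ put $\mathcal F/X=\{Y\subseteq E\setminus X: X\cup Y\in\mathcal F\}$ and $\Gamma(X)=\{x\in E\setminus X: X\cup\{x\}\in\mathcal F\}$. Write $X\sim Y$ if $\mathcal F/X=\mathcal F/Y$; the equivalence classes $[X]$ are the flats, and $\Gamma([X])=\Gamma(X)$. The set $\Phi$ of flats is a lattice under the order in which $[X]\le[Y]$ iff $Y\cup Z\sim X$ for some $Z\in\mathcal F/Y$; its top element is $\hat1=[\emptyset]$. For $A\in\Phi$ let $\xi(A)$ be the union of the feasible sets in $A$; for $S\subseteq E$ let $\mu(S)=[X]$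 for any inclusion-maximal feasible set $X\subseteq S$ (this does not depend on $X$). A signed flat is a pair $(A,a)$ with $A\in\Phi$ and $a:\Gamma(A)\to\{+,-\}$. Its covector is the map $\alpha:E\to\{0,+,-,1\}$ equal to $a$ on $\Gamma(A)$, to $0$ on $\xi(A)$, and to $1$ elsewhere; the flat is recovered as $\operatorname{supp}(\alpha)=\mu(\{e:\alpha(e)=0\})$. Covectors are ordered by: $\alpha\le\beta$ iff $\operatorname{supp}(\alpha)\le\operatorname{supp}(\beta)$ and $\alpha,\beta$ agree on $\Gamma(\operatorname{supp}\alpha)\cap\Gamma(\operatorname{supp}\beta)$. Order the symbols by $0<+<1$, $0<-<1$, with $+$ and $-$ incomparable. With $C=\operatorname{supp}(\alpha)\vee\operatorname{supp}(\beta)$, the product $\alpha\circ\beta$ is defined as follows: $(\alpha\circ\beta)(e)=1$ if $e\notin\Gamma(C)\cup\xi(C)$; otherwise $(\alpha\circ\beta)(e)$ is $\beta(e)$ if $\beta(e)>\alpha(e)$, and $\alpha(e)$ if not. Let $-\alpha$ be $\alpha$ with $+$ and $-$ exchanged, and $S(\alpha,\beta)=\{e:\alpha(e)=-\beta(e)\in\{+,-\}\}$.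 An oriented interval greedoid $(E,\mathcal F,\mathcal L)$ is an interval greedoid $(E,\mathcal F)$ with a set $\mathcal L$ of covectors of it such that: (OG1) $\operatorname{supp}:\mathcal L\to\Phi$ is surjective; (OG2) $-\alpha\in\mathcal L$ for $\alpha\in\mathcal L$; (OG3) $\alpha\circ\beta\in\mathcal L$ for $\alpha,\beta\in\mathcal L$; (OG4) if $\alpha,\beta\in\mathcal L$, $x\in S(\alpha,\beta)$ and $(\alpha\circ\beta)(x)\ne1$, then there is $\gamma\in\mathcal L$ with $\gamma(x)=0$ and $\gamma(y)=(\alpha\circ\beta)(y)=(\beta\circ\alpha)(y)$ for all $y\notin S(\alpha,\beta)$ with $(\alpha\circ\beta)(y)\ne1$. Its topes are the maximal elements of $\mathcal L$. **Proposition.** Let $(E,\mathcal F,\mathcal L)$ be an oriented interval greedoid with lattice of flats $\Phi$, and let $\mu_\Phi$ be the Möbius function of $\Phi$. Then the number of topes of $\mathcal L$ is $$\sum_{B\in\Phi}|\mu_\Phi(B,\hat1)|.$$ -/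

import Mathlib

/-- An interval greedoid on a finite ground set `E`: a nonempty family of feasible sets that
satisfies accessibility, exchange and the interval property. -/
structure IntervalGreedoid (E : Type*) [DecidableEq E] where
  feasible : Set (Finset E)
  nonempty : feasible.Nonempty
  ig1 : ∀ X ∈ feasible, X ≠ ∅ → ∃ x ∈ X, X.erase x ∈ feasible
  ig2 : ∀ X ∈ feasible, ∀ Y ∈ feasible, Y.card < X.card →
    ∃ x ∈ X \ Y, insert x Y ∈ feasible
  ig3 : ∀ X ∈ feasible, ∀ Y ∈ feasible, ∀ Z ∈ feasible, X ⊆ Y → Y ⊆ Z →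
    ∀ e, e ∉ Z → insert e X ∈ feasible → insert e Z ∈ feasible → insert e Y ∈ feasible

namespace IntervalGreedoid

variable {E : Type*} [DecidableEq E] (G : IntervalGreedoid E)

/-- The sets that can be added to `X`: all `Y ⊆ E \ X` such that `X ∪ Y` is feasible. -/
def contraction (X : Finset E) : Set (Finset E) :=
  {Y | Disjoint X Y ∧ X ∪ Y ∈ G.feasible}

/-- The continuations of a set. -/
def contOf (X : Finset E) : Set E := {x | x ∉ X ∧ insert x X ∈ G.feasible}

theorem mem_contOf_iff (X : Finset E) (x : E) : x ∈ G.contOf X ↔ {x} ∈ G.contraction X := by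
  simp [contOf, contraction, Finset.union_comm X]

/-- Two feasible sets are equivalent if their contractions coincide. -/
instance flatSetoid : Setoid {X : Finset E // X ∈ G.feasible} where
  r X Y := G.contraction X.1 = G.contraction Y.1
  iseqv := ⟨fun _ => rfl, fun h => h.symm, fun h h' => h.trans h'⟩

/-- The flats: equivalence classes of feasible sets. -/
def Flat : Type _ := Quotient G.flatSetoid

/-- The flat `[X]` of a feasible set. -/
def flat (X : Finset E) (hX : X ∈ G.feasible) : G.Flat := Quotient.mk G.flatSetoid ⟨X, hX⟩

variable {G}

theorem flat_eq {X Y : Finset E} {hX : X ∈ G.feasible} {hY : Y ∈ G.feasible} :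
    G.flat X hX = G.flat Y hY ↔ G.contraction X = G.contraction Y :=
  ⟨fun h => Quotient.exact h, fun h => Quotient.sound h⟩

theorem exists_flat (A : G.Flat) : ∃ X, ∃ hX : X ∈ G.feasible, A = G.flat X hX := by
  induction A using Quotient.inductionOn with
  | _ X => exact ⟨X.1, X.2, rfl⟩

/-- The continuations `Γ(A)` of a flat. -/
def cont (A : G.Flat) : Set E :=
  Quotient.lift (fun X : {X : Finset E // X ∈ G.feasible} => G.contOf X.1)
    (fun X Y h => by
      ext x
      have h' : G.contraction X.1 = G.contraction Y.1 := h
      simp only [mem_contOf_iff, h']) A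

/-- `ξ(A)`: the union of all feasible sets in the class `A`. -/
def xi (A : G.Flat) : Set E := {e | ∃ X, ∃ hX : X ∈ G.feasible, G.flat X hX = A ∧ e ∈ X}

/-- `[X] ≤ [Y]` iff some `Z` with `Y ∪ Z` feasible, `Z` disjoint from `Y`, has `Y ∪ Z ∼ X`. -/
def flatLE (A B : G.Flat) : Prop :=
  ∃ Y, ∃ hY : Y ∈ G.feasible, G.flat Y hY = B ∧
    ∃ Z, ∃ hZ : Z ∈ G.contraction Y, G.flat (Y ∪ Z) hZ.2 = A

theorem contraction_union {X Z : Finset E} (hZ : Z ∈ G.contraction X) (W : Finset E) :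
    W ∈ G.contraction (X ∪ Z) ↔ Disjoint Z W ∧ Z ∪ W ∈ G.contraction X := by
  simp only [contraction, Set.mem_ofPred_eq, Finset.disjoint_union_left,
    Finset.disjoint_union_right, Finset.union_assoc]
  have := hZ.1
  tauto

theorem contraction_union_congr {X Y Z : Finset E} (h : G.contraction X = G.contraction Y)
    (hZ : Z ∈ G.contraction X) : G.contraction (X ∪ Z) = G.contraction (Y ∪ Z) := by
  ext W
  rw [contraction_union hZ, contraction_union (h ▸ hZ), h]

/-- The order does not depend on the representatives. -/
theorem flatLE_iff {X Y : Finset E} (hX : X ∈ G.feasible) (hY : Y ∈ G.feasible) :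
    flatLE (G.flat X hX) (G.flat Y hY) ↔
      ∃ Z ∈ G.contraction Y, G.contraction (Y ∪ Z) = G.contraction X := by
  constructor
  · rintro ⟨Y', hY', h, Z, hZ, h'⟩
    rw [flat_eq] at h h'
    exact ⟨Z, h ▸ hZ, (contraction_union_congr h hZ).symm.trans h'⟩
  · rintro ⟨Z, hZ, h⟩
    exact ⟨Y, hY, rfl, Z, hZ, flat_eq.2 h⟩

instance : PartialOrder G.Flat where
  le := flatLE
  le_refl A := by
    obtain ⟨X, hX, rfl⟩ := exists_flat A
    exact (flatLE_iff hX hX).2 ⟨∅, by simpa [contraction] using hX, by simp⟩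
  le_trans A B C := by
    obtain ⟨X, hX, rfl⟩ := exists_flat A
    obtain ⟨Y, hY, rfl⟩ := exists_flat B
    obtain ⟨W, hW, rfl⟩ := exists_flat C
    simp only [flatLE_iff]
    rintro ⟨Z, hZ, h⟩ ⟨V, hV, h'⟩
    have hZ' : Z ∈ G.contraction (W ∪ V) := h' ▸ hZ
    refine ⟨V ∪ Z, ((contraction_union hV Z).1 hZ').2, ?_⟩
    rw [← Finset.union_assoc, contraction_union_congr h' hZ', h]
  le_antisymm A B := by
    obtain ⟨X, hX, rfl⟩ := exists_flat A
    obtain ⟨Y, hY, rfl⟩ := exists_flat B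
    simp only [flatLE_iff, flat_eq]
    rintro ⟨Z, hZ, h⟩ ⟨W, hW, h'⟩
    have hW' : W ∈ G.contraction (Y ∪ Z) := h ▸ hW
    have h1 := ((contraction_union hZ W).1 hW').2
    have h2 : G.contraction (Y ∪ (Z ∪ W)) = G.contraction Y := by
      rw [← Finset.union_assoc, contraction_union_congr h hW', h']
    have h3 := h1
    rw [← h2, contraction_union h1] at h3
    have h4 : Z ∪ W = ∅ := by simpa using h3.1
    have h5 : Z = ∅ := (Finset.union_eq_empty.1 h4).1
    subst h5
    rw [← h, Finset.union_empty]

theorem flat_le_flat {X Y : Finset E} (hX : X ∈ G.feasible) (hY : Y ∈ G.feasible)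
    (h : Y ⊆ X) : G.flat X hX ≤ G.flat Y hY :=
  (flatLE_iff hX hY).2 ⟨X \ Y, ⟨Finset.disjoint_sdiff,
    by rwa [Finset.union_sdiff_of_subset h]⟩, by rw [Finset.union_sdiff_of_subset h]⟩

theorem empty_mem : ∅ ∈ G.feasible := by
  obtain ⟨X, hX⟩ := G.nonempty
  induction hn : X.card generalizing X with
  | zero => rwa [Finset.card_eq_zero.1 hn] at hX
  | succ n ih =>
    obtain ⟨x, hx, h⟩ := G.ig1 X hX (by rintro rfl; simp at hn)
    exact ih _ h (by rw [Finset.card_erase_of_mem hx, hn]; rfl)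

/-- The top element of the poset of flats is `[∅]`. -/
instance : OrderTop G.Flat where
  top := G.flat ∅ empty_mem
  le_top A := by
    obtain ⟨X, hX, rfl⟩ := exists_flat A
    exact flat_le_flat _ _ (Finset.empty_subset X)

theorem exists_augment {X : Finset E} (hX : X ∈ G.feasible) (Y : Finset E)
    (hY : Y ∈ G.feasible) (h : Y.card ≤ X.card) :
    ∃ Z ∈ G.feasible, Y ⊆ Z ∧ Z ⊆ X ∪ Y ∧ Z.card = X.card := by
  induction hn : X.card - Y.card generalizing Y with
  | zero => exact ⟨Y, hY, subset_rfl, Finset.subset_union_right, by omega⟩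
  | succ n ih =>
    obtain ⟨x, hx, hxY⟩ := G.ig2 X hX Y hY (by omega)
    rw [Finset.mem_sdiff] at hx
    have hc := Finset.card_insert_of_notMem hx.2
    obtain ⟨Z, hZ, h1, h2, h3⟩ := ih _ hxY (by omega) (by omega)
    refine ⟨Z, hZ, (Finset.subset_insert x Y).trans h1, h2.trans ?_, h3⟩
    intro y
    simp only [Finset.mem_union, Finset.mem_insert]
    rintro (h | rfl | h)
    · exact Or.inl h
    · exact Or.inl hx.1
    · exact Or.inr h

/-- `X` is maximal with respect to inclusion among the feasible sets contained in `S`. -/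
def IsMaxFeasible (G : IntervalGreedoid E) (S : Set E) (X : Finset E) : Prop :=
  Maximal (fun Y : Finset E => Y ∈ G.feasible ∧ (Y : Set E) ⊆ S) X

theorem IsMaxFeasible.card_le {S : Set E} {X Y : Finset E} (hX : G.IsMaxFeasible S X)
    (hY : Y ∈ G.feasible) (hYS : (Y : Set E) ⊆ S) : Y.card ≤ X.card := by
  by_contra! h
  obtain ⟨x, hx, hxX⟩ := G.ig2 Y hY X hX.1.1 h
  rw [Finset.mem_sdiff] at hx
  refine hx.2 (hX.2 ⟨hxX, ?_⟩ (Finset.subset_insert x X) (Finset.mem_insert_self x X))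
  rw [Finset.coe_insert]
  exact Set.insert_subset (hYS hx.1) hX.1.2

theorem isMaxFeasible_of_card {S : Set E} {X Y : Finset E} (hX : G.IsMaxFeasible S X)
    (hY : Y ∈ G.feasible) (hYS : (Y : Set E) ⊆ S) (h : Y.card = X.card) :
    G.IsMaxFeasible S Y :=
  ⟨⟨hY, hYS⟩, fun Z hZ hYZ =>
    (Finset.eq_of_subset_of_card_le hYZ (h ▸ hX.card_le hZ.1 hZ.2)).ge⟩

theorem contraction_exchange {A U V : Finset E} {v : E} (hA : A ∈ G.feasible)
    (hU : U ∈ G.feasible) (hV : V ∈ G.feasible) (hAU : A ⊆ U) (hAv : insert v A ∈ G.feasible)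
    (hvV : v ∈ V) (hvU : v ∉ U) (hVU : V ⊆ insert v U) (hc : V.card = U.card)
    (hUv : insert v U ∉ G.feasible) : G.contraction U ⊆ G.contraction V := by
  rintro W ⟨hd, hW⟩
  have key : ∀ n, n ≤ W.card → ∃ T ∈ G.feasible, U ⊆ T ∧ T ⊆ U ∪ W ∧ v ∉ T ∧
      T.card = U.card + n ∧ V ∪ (T \ U) ∈ G.feasible := by
    intro n
    induction n with
    | zero => exact fun _ => ⟨U, hU, subset_rfl, Finset.subset_union_left, hvU, rfl, by simpa⟩
    | succ n ih =>
      intro hn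
      obtain ⟨T, hT, hUT, hTW, hvT, hTc, hVT⟩ := ih (by omega)
      have hWc := Finset.card_union_of_disjoint hd
      obtain ⟨x, hx, hxT⟩ := G.ig2 _ hW T hT (by omega)
      rw [Finset.mem_sdiff] at hx
      have hxU : x ∉ U := fun h => hx.2 (hUT h)
      have hxv : v ≠ x := by
        rintro rfl
        exact hUv (G.ig3 A hA U hU T hT hAU hUT v hvT hAv hxT)
      have hcx := Finset.card_insert_of_notMem hx.2
      have hdis : Disjoint V (T \ U) := by
        rw [Finset.disjoint_left]
        intro y hy hyT
        rw [Finset.mem_sdiff] at hyT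
        rcases Finset.mem_insert.1 (hVU hy) with rfl | h
        · exact hvT hyT.1
        · exact hyT.2 h
      have hcV : (V ∪ (T \ U)).card = T.card := by
        rw [Finset.card_union_of_disjoint hdis, Finset.card_sdiff_of_subset hUT]
        have := Finset.card_le_card hUT
        omega
      refine ⟨insert x T, hxT, hUT.trans (Finset.subset_insert _ _),
        Finset.insert_subset hx.1 hTW, by simp [hxv, hvT], by omega, ?_⟩
      have hins : insert x T \ U = insert x (T \ U) := Finset.insert_sdiff_of_notMem _ hxU
      rw [hins, Finset.union_insert]
      obtain ⟨y, hy, hyV⟩ := G.ig2 _ hxT _ hVT (by omega)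
      rw [Finset.mem_sdiff] at hy
      rcases Finset.mem_insert.1 hy.1 with rfl | hyT
      · exact hyV
      · exfalso
        have hsub : insert y (V ∪ (T \ U)) ⊆ insert v T := by
          refine Finset.insert_subset (Finset.mem_insert_of_mem hyT)
            (Finset.union_subset (hVU.trans (Finset.insert_subset_insert v hUT))
              (Finset.sdiff_subset.trans (Finset.subset_insert v T)))
        have heq := Finset.eq_of_subset_of_card_le hsub (by
          rw [Finset.card_insert_of_notMem hy.2, Finset.card_insert_of_notMem hvT, hcV])
        rw [heq] at hyV
        exact hUv (G.ig3 A hA U hU T hT hAU hUT v hvT hAv hyV)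
  obtain ⟨T, hT, hUT, hTW, hvT, hTc, hVT⟩ := key W.card le_rfl
  have hTeq : T = U ∪ W := Finset.eq_of_subset_of_card_le hTW (by
    rw [Finset.card_union_of_disjoint hd, hTc])
  have hTU : T \ U = W := by
    rw [hTeq, Finset.union_sdiff_left, Finset.sdiff_eq_self_of_disjoint hd.symm]
  rw [hTU] at hVT
  refine ⟨?_, hVT⟩
  rw [Finset.disjoint_left]
  intro y hy hyW
  rcases Finset.mem_insert.1 (hVU hy) with rfl | h
  · exact hvT (hTeq ▸ Finset.mem_union_right _ hyW)
  · exact Finset.disjoint_left.1 hd h hyW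

theorem IsMaxFeasible.contraction_subset {S : Set E} {U V : Finset E}
    (hU : G.IsMaxFeasible S U) (hV : G.IsMaxFeasible S V) :
    G.contraction U ⊆ G.contraction V := by
  have hUV := le_antisymm (hV.card_le hU.1.1 hU.1.2) (hU.card_le hV.1.1 hV.1.2)
  have key : ∀ n, ∀ A ∈ G.feasible, A ⊆ V → V.card = A.card + n → ∀ U : Finset E,
      G.IsMaxFeasible S U → U.card = V.card → A ⊆ U → G.contraction U ⊆ G.contraction V := by
    intro n
    induction n with
    | zero =>
      intro A hA hAV hn U hU hUV hAU
      have h1 := Finset.eq_of_subset_of_card_le hAV (by omega)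
      have h2 := Finset.eq_of_subset_of_card_le hAU (by omega)
      rw [← h1, ← h2]
    | succ n ih =>
      intro A hA hAV hn U hU hUV hAU
      obtain ⟨v, hv, hvA⟩ := G.ig2 V hV.1.1 A hA (by omega)
      rw [Finset.mem_sdiff] at hv
      have hc := Finset.card_insert_of_notMem hv.2
      have hvV : insert v A ⊆ V := Finset.insert_subset hv.1 hAV
      by_cases hvU : v ∈ U
      · exact ih _ hvA hvV (by omega) U hU hUV (Finset.insert_subset hvU hAU)
      · obtain ⟨U', hU', h1, h2, h3⟩ := exists_augment hU.1.1 _ hvA (by omega)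
        have h4 : U' ⊆ insert v U := h2.trans (Finset.union_subset (Finset.subset_insert v U)
          (Finset.insert_subset_insert v hAU))
        have h5 : ((insert v U : Finset E) : Set E) ⊆ S := by
          rw [Finset.coe_insert]
          exact Set.insert_subset (hV.1.2 hv.1) hU.1.2
        have h6 : insert v U ∉ G.feasible := fun h => by
          have := hU.card_le h h5
          rw [Finset.card_insert_of_notMem hvU] at this
          omega
        have h7 : G.IsMaxFeasible S U' :=
          isMaxFeasible_of_card hU hU' ((Finset.coe_subset.2 h4).trans h5) h3
        exact (contraction_exchange hA hU.1.1 hU' hAU hvA (h1 (Finset.mem_insert_self v A))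
          hvU h4 h3 h6).trans (ih _ hvA hvV (by omega) U' h7 (by omega) h1)
  exact key V.card ∅ empty_mem (Finset.empty_subset V) (by simp) U hU hUV
    (Finset.empty_subset U)

variable [Fintype E]

theorem exists_isMaxFeasible (G : IntervalGreedoid E) (S : Set E) :
    ∃ X, G.IsMaxFeasible S X :=
  (Set.toFinite {Y : Finset E | Y ∈ G.feasible ∧ (Y : Set E) ⊆ S}).exists_maximal
    ⟨∅, empty_mem, by simp⟩

/-- `μ(S) = [X]`, where `X` is any maximal feasible subset of `S`. -/
noncomputable def flatOf (G : IntervalGreedoid E) (S : Set E) : G.Flat :=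
  G.flat (G.exists_isMaxFeasible S).choose (G.exists_isMaxFeasible S).choose_spec.1.1

/-- `μ` does not depend on the choice of the maximal feasible subset. -/
theorem flatOf_eq {S : Set E} {X : Finset E} (hX : G.IsMaxFeasible S X) :
    G.flatOf S = G.flat X hX.1.1 := by
  have h := (G.exists_isMaxFeasible S).choose_spec
  exact flat_eq.2 (Set.Subset.antisymm (h.contraction_subset hX) (hX.contraction_subset h))

theorem isMaxFeasible_xi {X : Finset E} (hX : X ∈ G.feasible) :
    G.IsMaxFeasible (xi (G.flat X hX)) X := by
  refine ⟨⟨hX, fun e he => ⟨X, hX, rfl, he⟩⟩, fun T hT hXT => ?_⟩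
  by_contra hne
  obtain ⟨x, hx, hxX⟩ := G.ig2 T hT.1 X hX (Finset.card_lt_card ⟨hXT, hne⟩)
  rw [Finset.mem_sdiff] at hx
  obtain ⟨X', hX', h, hxX'⟩ := hT.2 hx.1
  have h1 : x ∈ G.contOf X := ⟨hx.2, hxX⟩
  rw [mem_contOf_iff, ← flat_eq.1 h, ← mem_contOf_iff] at h1
  exact h1.1 hxX'

theorem flatOf_xi (A : G.Flat) : G.flatOf (xi A) = A := by
  obtain ⟨X, hX, rfl⟩ := exists_flat A
  exact flatOf_eq (isMaxFeasible_xi hX)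

theorem flatOf_le {S : Set E} {Y : Finset E} (hY : Y ∈ G.feasible) (hYS : (Y : Set E) ⊆ S) :
    G.flatOf S ≤ G.flat Y hY := by
  obtain ⟨X, hX⟩ := G.exists_isMaxFeasible S
  obtain ⟨Z, hZ, h1, h2, h3⟩ := exists_augment hX.1.1 Y hY (hX.card_le hY hYS)
  have hZm : G.IsMaxFeasible S Z := isMaxFeasible_of_card hX hZ
    ((Finset.coe_subset.2 h2).trans (by rw [Finset.coe_union]
                                        exact Set.union_subset hX.1.2 hYS)) h3
  rw [flatOf_eq hZm]
  exact flat_le_flat _ _ h1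

theorem flatOf_anti {S T : Set E} (h : S ⊆ T) : G.flatOf T ≤ G.flatOf S :=
  flatOf_le _ ((G.exists_isMaxFeasible S).choose_spec.1.2.trans h)

theorem xi_anti {A B : G.Flat} (h : A ≤ B) : xi B ⊆ xi A := by
  rintro e ⟨Y, hY, rfl, he⟩
  obtain ⟨X, hX, rfl⟩ := exists_flat A
  obtain ⟨Z, hZ, h'⟩ := (flatLE_iff hX hY).1 h
  exact ⟨Y ∪ Z, hZ.2, flat_eq.2 h', Finset.mem_union_left Z he⟩

/-- The lattice of flats: `A ∨ B = μ(ξ(A) ∩ ξ(B))` and `A ∧ B = μ(ξ(A) ∪ ξ(B))`. -/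
noncomputable instance : Lattice G.Flat where
  sup A B := G.flatOf (xi A ∩ xi B)
  inf A B := G.flatOf (xi A ∪ xi B)
  le_sup_left A B := (flatOf_xi A).ge.trans (flatOf_anti Set.inter_subset_left)
  le_sup_right A B := (flatOf_xi B).ge.trans (flatOf_anti Set.inter_subset_right)
  sup_le A B C h h' := (flatOf_anti (Set.subset_inter (xi_anti h) (xi_anti h'))).trans
    (flatOf_xi C).le
  inf_le_left A B := (flatOf_anti Set.subset_union_left).trans (flatOf_xi A).le
  inf_le_right A B := (flatOf_anti Set.subset_union_right).trans (flatOf_xi B).le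
  le_inf A B C h h' := (flatOf_xi A).ge.trans
    (flatOf_anti (Set.union_subset (xi_anti h) (xi_anti h')))

instance : Finite G.Flat := inferInstanceAs (Finite (Quotient G.flatSetoid))

noncomputable instance : Fintype G.Flat := Fintype.ofFinite _

noncomputable instance : DecidableEq G.Flat := Classical.decEq _

open Classical in
noncomputable instance : LocallyFiniteOrder G.Flat := Fintype.toLocallyFiniteOrder

end IntervalGreedoid

/-- The values `0, +, -, 1` of covectors. -/
inductive CovSign : Type
  | zero | pos | neg | one

namespace CovSign

/-- The order on symbols: `0` is the least, `1` the greatest, and `+`, `-` are incomparable. -/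
instance : PartialOrder CovSign where
  le a b := a = b ∨ a = zero ∨ b = one
  le_refl a := Or.inl rfl
  le_trans a b c := by cases a <;> cases b <;> cases c <;> simp
  le_antisymm a b := by cases a <;> cases b <;> simp

/-- Exchange `+` and `-`. -/
def opp : CovSign → CovSign
  | zero => zero
  | pos => neg
  | neg => pos
  | one => one

open Classical in
/-- `a ⋆ b` is `b` if `b > a`, and `a` otherwise. -/
noncomputable def star (a b : CovSign) : CovSign := if a < b then b else a

end CovSign

namespace IntervalGreedoid

variable {E : Type*} [DecidableEq E] [Fintype E]

/-- A signed flat: a flat with a map from its continuations to `{+, -}`. -/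
structure SignedFlat (G : IntervalGreedoid E) where
  flat : G.Flat
  sign : cont flat → ℤˣ

open Classical in
/-- The covector of a signed flat. -/
noncomputable def SignedFlat.covector {G : IntervalGreedoid E} (a : G.SignedFlat) (e : E) :
    CovSign :=
  if h : e ∈ cont a.flat then (if a.sign ⟨e, h⟩ = 1 then CovSign.pos else CovSign.neg)
  else if e ∈ xi a.flat then CovSign.zero
  else CovSign.one

/-- The covectors of an interval greedoid. -/
def allCovectors (G : IntervalGreedoid E) : Set (E → CovSign) :=
  Set.range (SignedFlat.covector (G := G))

/-- `supp(α) = μ({e | α(e) = 0})`. -/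
noncomputable def supp (G : IntervalGreedoid E) (α : E → CovSign) : G.Flat :=
  G.flatOf {e | α e = CovSign.zero}

open Classical in
/-- The product `α ∘ β` of covectors. -/
noncomputable def comp (G : IntervalGreedoid E) (α β : E → CovSign) (e : E) : CovSign :=
  if e ∈ cont (G.supp α ⊔ G.supp β) ∪ xi (G.supp α ⊔ G.supp β) then CovSign.star (α e) (β e)
  else CovSign.one

/-- The partial order on covectors, inherited from the one on signed flats. -/
def covectorLE (G : IntervalGreedoid E) (α β : E → CovSign) : Prop :=
  G.supp α ≤ G.supp β ∧ ∀ e ∈ cont (G.supp α) ∩ cont (G.supp β), α e = β e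

end IntervalGreedoid

/-- The separation set of two covectors. -/
def separationSet {E : Type*} (α β : E → CovSign) : Set E :=
  {e | α e = (β e).opp ∧ (α e = CovSign.pos ∨ α e = CovSign.neg)}

/-- An oriented interval greedoid structure on the interval greedoid `G`. -/
structure OrientedIntervalGreedoid {E : Type*} [DecidableEq E] [Fintype E]
    (G : IntervalGreedoid E) where
  covectors : Set (E → CovSign)
  subset_allCovectors : covectors ⊆ G.allCovectors
  og1 : ∀ A : G.Flat, ∃ α ∈ covectors, G.supp α = A
  og2 : ∀ α ∈ covectors, (fun e => (α e).opp) ∈ covectors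
  og3 : ∀ α ∈ covectors, ∀ β ∈ covectors, G.comp α β ∈ covectors
  og4 : ∀ α ∈ covectors, ∀ β ∈ covectors, ∀ x ∈ separationSet α β,
    G.comp α β x ≠ CovSign.one →
      ∃ γ ∈ covectors, γ x = CovSign.zero ∧
        ∀ y, y ∉ separationSet α β → G.comp α β y ≠ CovSign.one →
          γ y = G.comp α β y ∧ γ y = G.comp β α y

/-- The topes: the covectors that are maximal in the partial order on covectors. -/
def OrientedIntervalGreedoid.topes {E : Type*} [DecidableEq E] [Fintype E]
    {G : IntervalGreedoid E} (O : OrientedIntervalGreedoid G) : Set (E → CovSign) :=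
  {α | α ∈ O.covectors ∧ ∀ β ∈ O.covectors, G.covectorLE α β → β = α}

/-!
Let `I = Γ(⊤)` be the set of continuations of the empty set and, for `e ∈ I`, let `c e = [{e}]` be
the corresponding coatom of the lattice of flats, encoded as `G.flatOf {e}`. The number of topes is
obtained by the deletion-contraction argument of Las Vergnas and Zaslavsky, which only involves
the values of covectors on `I`.

By the exchange axiom each element of `I` lies in `Γ(A)` or in `ξ(A)`, for every flat `A`
(`cont_top_subset`). Hence covectors take only the values `0`, `+`, `-` on `I`, and on `I` the
product and the elimination axiom are those of an oriented matroid. A tope is a covector of support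
`⊤`, that is, one without zeros on `I`, and it is determined by its values on `I`.

For `J ⊆ I` and a flat `A` let `N(J, A)` be the number of sign patterns on `J` of the covectors with
support at most `A` and without zeros on `J`, so that `N(I, ⊤)` is the number of topes. If `A ≤ c e`
then all these covectors vanish at `e`, so `N(J ∪ {e}, A) = 0`. Otherwise every pattern on `J`
extends by `+` or by `-` at `e`, and it extends by both if and only if it extends by `0`: one
direction is elimination, the other composition with a covector and its negative. This gives
`N(J ∪ {e}, A) = N(J, A) + N(J, A ⊓ c e)` (`ncard_patterns_insert`).

On the lattice side let `f(J, A, B)` be the sum of `(-1) ^ |S|` over the `S ⊆ J` with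
`A ⊓ ⨅ i ∈ S, c i = B` (`altSum`). By the crosscut theorem `f(I, ⊤, B) = μ(B, ⊤)`
(`altSum_top_eq_mu`). It satisfies `f(J ∪ {e}, A, B) = f(J, A, B) - f(J, A ⊓ c e, B)`. When
`A ≤ c e` fails, `A ⊓ c e` has rank one more than `A`, so the two terms have opposite signs and the
absolute values add up. Therefore `∑ B, |f(J, A, B)|` satisfies the recursion of `N(J, A)`, and both
are `1` for `J = ∅`.
-/

/-! ### Alternating sums over sets of coatoms -/

section AltSum

variable {ι α : Type*} [DecidableEq ι] [SemilatticeInf α] [OrderTop α] [DecidableEq α]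

/-- The alternating sum of `(-1) ^ |S|` over the sets `S ⊆ J` for which the meet of `A` with all
`c i`, `i ∈ S`, is `B`. -/
def altSum (c : ι → α) (J : Finset ι) (A B : α) : ℤ :=
  ∑ S ∈ J.powerset with A ⊓ S.inf c = B, (-1) ^ S.card

variable (c : ι → α)

omit [DecidableEq ι] in
theorem altSum_empty (A B : α) : altSum c ∅ A B = if A = B then 1 else 0 := by
  simp [altSum, Finset.sum_filter]

theorem altSum_insert {J : Finset ι} {e : ι} (he : e ∉ J) (A B : α) :
    altSum c (insert e J) A B = altSum c J A B - altSum c J (A ⊓ c e) B := by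
  simp only [altSum, Finset.sum_filter]
  rw [Finset.sum_powerset_insert he, sub_eq_add_neg, ← Finset.sum_neg_distrib]
  congr 1
  refine Finset.sum_congr rfl fun S hS => ?_
  have heS : e ∉ S := fun h => he (Finset.mem_powerset.1 hS h)
  rw [Finset.card_insert_of_notMem heS, Finset.inf_insert, ← inf_assoc, pow_succ]
  split_ifs <;> ring

theorem altSum_insert_of_le {J : Finset ι} {e : ι} (he : e ∉ J) {A : α} (h : A ≤ c e) (B : α) :
    altSum c (insert e J) A B = 0 := by
  rw [altSum_insert c he, inf_eq_left.2 h, sub_self]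

/-- If meeting with `c e` raises `r` by one whenever it changes an element, then the sign of
`altSum c J A B` is the parity of `r B - r A`. -/
theorem altSum_sign {r : α → ℕ} {J : Finset ι}
    (hr : ∀ e ∈ J, ∀ A, ¬ A ≤ c e → r (A ⊓ c e) = r A + 1) (A B : α) :
    0 ≤ (-1) ^ (r A + r B) * altSum c J A B := by
  induction J using Finset.induction_on generalizing A with
  | empty =>
    rw [altSum_empty]
    split_ifs with h
    · subst h
      rw [← two_mul, pow_mul]
      simp
    · simp
  | insert e J he ih =>
    have ih' := ih fun i hi => hr i (Finset.mem_insert_of_mem hi)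
    by_cases h : A ≤ c e
    · simp [altSum_insert_of_le c he h]
    · have h1 := ih' A
      have h2 := ih' (A ⊓ c e)
      rw [hr e (Finset.mem_insert_self e J) A h] at h2
      rw [altSum_insert c he]
      have h3 : (-1 : ℤ) ^ (r A + 1 + r B) = -(-1) ^ (r A + r B) := by ring
      rw [h3] at h2
      linarith

theorem abs_altSum_eq {r : α → ℕ} {J : Finset ι}
    (hr : ∀ e ∈ J, ∀ A, ¬ A ≤ c e → r (A ⊓ c e) = r A + 1) (A B : α) :
    |altSum c J A B| = (-1) ^ (r A + r B) * altSum c J A B := by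
  rw [← abs_of_nonneg (altSum_sign c hr A B), abs_mul, abs_pow, abs_neg, abs_one, one_pow, one_mul]

theorem abs_altSum_insert {r : α → ℕ} {J : Finset ι} {e : ι} (he : e ∉ J)
    (hr : ∀ i ∈ insert e J, ∀ A, ¬ A ≤ c i → r (A ⊓ c i) = r A + 1) {A : α} (h : ¬ A ≤ c e)
    (B : α) :
    |altSum c (insert e J) A B| = |altSum c J A B| + |altSum c J (A ⊓ c e) B| := by
  have hr' : ∀ i ∈ J, ∀ A, ¬ A ≤ c i → r (A ⊓ c i) = r A + 1 := fun i hi =>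
    hr i (Finset.mem_insert_of_mem hi)
  rw [abs_altSum_eq c hr, abs_altSum_eq c hr', abs_altSum_eq c hr', altSum_insert c he,
    hr e (Finset.mem_insert_self e J) A h]
  ring

/-- A function that satisfies the deletion-contraction recursion of `∑ B, |altSum c J A B|` is
equal to that sum. -/
theorem eq_sum_abs_altSum [Fintype α] {r : α → ℕ} {N : Finset ι → α → ℕ} {I : Finset ι}
    (hr : ∀ e ∈ I, ∀ A, ¬ A ≤ c e → r (A ⊓ c e) = r A + 1)
    (h_empty : ∀ A, N ∅ A = 1)
    (h_loop : ∀ J : Finset ι, ∀ e ∈ I, ∀ A, A ≤ c e → N (insert e J) A = 0)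
    (h_insert : ∀ J ⊆ I, ∀ e ∈ I, e ∉ J → ∀ A, ¬ A ≤ c e →
      N (insert e J) A = N J A + N J (A ⊓ c e))
    {J : Finset ι} (hJ : J ⊆ I) (A : α) :
    (N J A : ℤ) = ∑ B, |altSum c J A B| := by
  induction J using Finset.induction_on generalizing A with
  | empty =>
    simp only [h_empty, altSum_empty, apply_ite abs, abs_one, abs_zero, Nat.cast_one]
    simp
  | insert e J he ih =>
    have heI := hJ (Finset.mem_insert_self e J)
    have hJI := (Finset.subset_insert e J).trans hJ
    by_cases h : A ≤ c e
    · simp [h_loop J e heI A h, altSum_insert_of_le c he h]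
    · rw [h_insert J hJI e heI he A h, Nat.cast_add, ih hJI, ih hJI, ← Finset.sum_add_distrib]
      exact Finset.sum_congr rfl fun B _ =>
        (abs_altSum_insert c he (fun i hi => hr i (hJ hi)) h B).symm

end AltSum

/-- The crosscut theorem for sets of elements below which every element other than `⊤` lies. -/
theorem altSum_top_eq_mu {ι α : Type*} [DecidableEq ι] [Lattice α] [OrderTop α] [DecidableEq α]
    [LocallyFiniteOrder α] (c : ι → α) {I : Finset ι} (h_ne : ∀ e ∈ I, c e ≠ ⊤)
    (h_le : ∀ B, B ≠ ⊤ → ∃ e ∈ I, B ≤ c e) (B : α) :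
    altSum c I ⊤ B = IncidenceAlgebra.mu ℤ B ⊤ := by
  classical
  have key := IncidenceAlgebra.moebius_inversion_top (𝕜 := ℤ) (altSum c I ⊤)
    (fun C => if C = ⊤ then 1 else 0) (fun C => ?_) B
  · rw [key, Finset.sum_eq_single_of_mem ⊤ (Finset.mem_Ici.2 le_top)
      (fun C _ hC => by simp [hC])]
    simp
  · have h1 : ∀ S : Finset ι, C ≤ S.inf c ↔ ∀ e ∈ S, C ≤ c e := fun S => Finset.le_inf_iff
    -- exchanging the sums leaves the alternating sum over all subsets of `{e ∈ I | C ≤ c e}`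
    have h2 : ∑ D ∈ Finset.Ici C, altSum c I ⊤ D =
        ∑ S ∈ (I.filter fun e => C ≤ c e).powerset, (-1) ^ S.card := by
      simp only [altSum, top_inf_eq, Finset.sum_filter]
      rw [Finset.sum_comm]
      simp only [Finset.sum_ite_eq, Finset.mem_Ici, h1]
      rw [← Finset.sum_filter]
      refine Finset.sum_congr ?_ fun _ _ => rfl
      ext S
      simp only [Finset.mem_filter, Finset.mem_powerset, Finset.subset_iff]
      exact forall₂_and.symm
    rw [h2, Finset.sum_powerset_neg_one_pow_card]
    refine if_congr ?_ rfl rfl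
    rw [Finset.filter_eq_empty_iff]
    refine ⟨?_, fun h => ?_⟩
    · rintro rfl e he h
      exact h_ne e he (top_le_iff.1 h)
    · by_contra hC
      obtain ⟨e, he, hCe⟩ := h_le C hC
      exact h he hCe

namespace IntervalGreedoid

variable {E : Type*} [DecidableEq E] {G : IntervalGreedoid E}

/-! ### Coatoms and ranks of flats -/

theorem disjoint_cont_xi (A : G.Flat) : Disjoint (cont A) (xi A) := by
  obtain ⟨X, hX, rfl⟩ := exists_flat A
  rw [Set.disjoint_left]
  rintro e he ⟨Y, hY, h, heY⟩
  have h1 : e ∈ cont (G.flat Y hY) := h ▸ he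
  exact h1.1 heY

theorem card_eq_of_flat_eq {X Y : Finset E} {hX : X ∈ G.feasible} {hY : Y ∈ G.feasible}
    (h : G.flat X hX = G.flat Y hY) : X.card = Y.card := by
  have key : ∀ {X Y : Finset E} {hX : X ∈ G.feasible} {hY : Y ∈ G.feasible},
      G.flat X hX = G.flat Y hY → X.card ≤ Y.card := fun {X Y hX hY} h => by
    by_contra! hlt
    obtain ⟨x, hx, hxY⟩ := G.ig2 X hX Y hY hlt
    rw [Finset.mem_sdiff] at hx
    have h1 : x ∈ cont (G.flat X hX) := h ▸ (⟨hx.2, hxY⟩ : x ∈ cont (G.flat Y hY))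
    exact h1.1 hx.1
  exact le_antisymm (key h) (key h.symm)

/-- The rank of a flat: the common cardinality of its feasible sets. -/
def rank (A : G.Flat) : ℕ :=
  Quotient.lift (fun X : {X : Finset E // X ∈ G.feasible} => X.1.card)
    (fun _ _ h => card_eq_of_flat_eq (Quotient.sound h)) A

theorem mem_cont_top {e : E} : e ∈ cont (⊤ : G.Flat) ↔ {e} ∈ G.feasible := by
  change e ∈ G.contOf ∅ ↔ _
  simp [contOf]

variable [Fintype E]

/-- Every continuation of the empty set is a continuation or a member of each flat. -/
theorem cont_top_subset (A : G.Flat) : cont (⊤ : G.Flat) ⊆ cont A ∪ xi A := by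
  intro e he
  rw [mem_cont_top] at he
  obtain ⟨X, hX, rfl⟩ := exists_flat A
  by_cases heX : e ∈ X
  · exact Or.inr ⟨X, hX, rfl, heX⟩
  by_cases hf : insert e X ∈ G.feasible
  · exact Or.inl ⟨heX, hf⟩
  right
  have hX0 : X.Nonempty := by
    rw [Finset.nonempty_iff_ne_empty]
    rintro rfl
    exact hf he
  -- exchange gives a feasible `Z ∋ e` in `X ∪ {e}` of the size of `X`, and `X` is maximal there
  obtain ⟨Z, hZ, h1, h2, h3⟩ := exists_augment hX {e} he (by simpa using hX0.card_pos)
  have hm : G.IsMaxFeasible ((insert e X : Finset E) : Set E) X := by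
    refine ⟨⟨hX, Finset.coe_subset.2 (Finset.subset_insert e X)⟩, fun Y hY hXY y hy => ?_⟩
    rcases Finset.mem_insert.1 (Finset.coe_subset.1 hY.2 hy) with rfl | h
    · have : Y = insert y X := (Finset.coe_subset.1 hY.2).antisymm (Finset.insert_subset hy hXY)
      exact absurd (this ▸ hY.1) hf
    · exact h
  have hmZ : G.IsMaxFeasible ((insert e X : Finset E) : Set E) Z := by
    refine isMaxFeasible_of_card hm hZ (Finset.coe_subset.2 (h2.trans ?_)) h3
    rw [Finset.union_comm]
    rfl
  exact ⟨Z, hZ, (flatOf_eq hmZ).symm.trans (flatOf_eq hm), h1 (Finset.mem_singleton_self e)⟩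

omit [Fintype E] in
theorem isMaxFeasible_self {X : Finset E} (hX : X ∈ G.feasible) : G.IsMaxFeasible X X :=
  ⟨⟨hX, subset_rfl⟩, fun _ hY _ => Finset.coe_subset.1 hY.2⟩

theorem flatOf_coe {X : Finset E} (hX : X ∈ G.feasible) : G.flatOf X = G.flat X hX :=
  flatOf_eq (isMaxFeasible_self hX)

theorem le_flatOf_singleton {e : E} (he : e ∈ cont (⊤ : G.Flat)) (A : G.Flat) :
    A ≤ G.flatOf {e} ↔ e ∈ xi A := by
  constructor
  · intro h
    rw [mem_cont_top] at he
    refine xi_anti h ⟨{e}, he, ?_, Finset.mem_singleton_self e⟩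
    rw [← flatOf_coe he, Finset.coe_singleton]
  · intro h
    exact (flatOf_xi A).ge.trans (flatOf_anti (Set.singleton_subset_iff.2 h))

theorem flatOf_singleton_ne_top {e : E} (he : e ∈ cont (⊤ : G.Flat)) : G.flatOf {e} ≠ ⊤ :=
  fun h => Set.disjoint_left.1 (disjoint_cont_xi ⊤) he ((le_flatOf_singleton he ⊤).1 h.ge)

theorem exists_le_flatOf_singleton {A : G.Flat} (hA : A ≠ ⊤) :
    ∃ e ∈ cont (⊤ : G.Flat), A ≤ G.flatOf {e} := by
  obtain ⟨X, hX, rfl⟩ := exists_flat A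
  have hX0 : X.Nonempty := by
    rw [Finset.nonempty_iff_ne_empty]
    rintro rfl
    exact hA rfl
  obtain ⟨x, hx, hxf⟩ := G.ig2 X hX ∅ empty_mem (by simpa using hX0.card_pos)
  have hx0 : x ∈ cont (⊤ : G.Flat) := ⟨Finset.notMem_empty x, hxf⟩
  exact ⟨x, hx0, (le_flatOf_singleton hx0 _).2 ⟨X, hX, rfl, (Finset.mem_sdiff.1 hx).1⟩⟩

theorem rank_inf_flatOf_singleton {e : E} (he : e ∈ cont (⊤ : G.Flat)) (A : G.Flat)
    (h : ¬ A ≤ G.flatOf {e}) : rank (A ⊓ G.flatOf {e}) = rank A + 1 := by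
  have heA : e ∈ cont A := (cont_top_subset A he).resolve_right
    fun h' => h ((le_flatOf_singleton he A).2 h')
  obtain ⟨X, hX, rfl⟩ := exists_flat A
  obtain ⟨heX, hf⟩ := heA
  have key : G.flat X hX ⊓ G.flatOf {e} = G.flat (insert e X) hf := by
    refine le_antisymm ?_ (le_inf (flat_le_flat _ _ (Finset.subset_insert e X)) ?_)
    · set D := G.flat X hX ⊓ G.flatOf {e}
      rw [← flatOf_xi D]
      refine flatOf_le hf ?_
      rw [Finset.coe_insert]
      exact Set.insert_subset ((le_flatOf_singleton he D).1 inf_le_right)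
        (fun x hx => xi_anti (inf_le_left : D ≤ _) ⟨X, hX, rfl, hx⟩)
    · exact (le_flatOf_singleton he _).2 ⟨_, hf, rfl, Finset.mem_insert_self e X⟩
  rw [key]
  exact Finset.card_insert_of_notMem heX

/-! ### Supports and values of covectors -/

namespace SignedFlat

omit [Fintype E] in
theorem covector_eq_zero_iff (a : G.SignedFlat) (e : E) :
    a.covector e = CovSign.zero ↔ e ∈ xi a.flat := by
  have : e ∈ cont a.flat → e ∉ xi a.flat := fun h => Set.disjoint_left.1 (disjoint_cont_xi _) h
  unfold covector
  split_ifs <;> simp_all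

theorem supp_covector (a : G.SignedFlat) : G.supp a.covector = a.flat := by
  simp only [supp, covector_eq_zero_iff]
  exact flatOf_xi a.flat

end SignedFlat

theorem eq_zero_iff_of_mem {α : E → CovSign} (hα : α ∈ G.allCovectors) (e : E) :
    α e = CovSign.zero ↔ e ∈ xi (G.supp α) := by
  obtain ⟨a, rfl⟩ := hα
  rw [a.supp_covector, a.covector_eq_zero_iff]

theorem mem_cont_supp_iff {α : E → CovSign} (hα : α ∈ G.allCovectors) (e : E) :
    e ∈ cont (G.supp α) ↔ α e = CovSign.pos ∨ α e = CovSign.neg := by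
  obtain ⟨a, rfl⟩ := hα
  rw [a.supp_covector]
  unfold SignedFlat.covector
  split_ifs <;> simp_all

theorem eq_of_eqOn_cont {α β : E → CovSign} (hα : α ∈ G.allCovectors) (hβ : β ∈ G.allCovectors)
    (hs : G.supp α = G.supp β) (h : ∀ e ∈ cont (G.supp α), α e = β e) : α = β := by
  ext e
  by_cases hc : e ∈ cont (G.supp α)
  · exact h e hc
  have h1 := (mem_cont_supp_iff hα e).not.1 hc
  have h2 := (mem_cont_supp_iff hβ e).not.1 (hs ▸ hc)
  have h3 : α e = CovSign.zero ↔ β e = CovSign.zero := by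
    rw [eq_zero_iff_of_mem hα, eq_zero_iff_of_mem hβ, hs]
  cases h4 : α e <;> cases h5 : β e <;> simp_all

theorem supp_le_iff {α : E → CovSign} (hα : α ∈ G.allCovectors) (A : G.Flat) :
    G.supp α ≤ A ↔ ∀ e ∈ xi A, α e = CovSign.zero := by
  constructor
  · intro h e he
    exact (eq_zero_iff_of_mem hα e).2 (xi_anti h he)
  · intro h
    exact (flatOf_anti h).trans (flatOf_xi A).le

theorem supp_le_flatOf_singleton {α : E → CovSign} (hα : α ∈ G.allCovectors) {e : E}
    (he : e ∈ cont (⊤ : G.Flat)) : G.supp α ≤ G.flatOf {e} ↔ α e = CovSign.zero := by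
  rw [le_flatOf_singleton he, eq_zero_iff_of_mem hα]

/-- The value `1` does not occur on the continuations of the empty set. -/
theorem ne_one_of_mem_cont_top {α : E → CovSign} (hα : α ∈ G.allCovectors) {e : E}
    (he : e ∈ cont (⊤ : G.Flat)) : α e ≠ CovSign.one := by
  rcases cont_top_subset (G.supp α) he with h | h
  · rcases (mem_cont_supp_iff hα e).1 h with h | h <;> simp [h]
  · simp [(eq_zero_iff_of_mem hα e).2 h]

end IntervalGreedoid

/-! ### Products of symbols and of covectors -/

namespace CovSign

instance : Finite CovSign :=
  Finite.of_surjective (fun i : Fin 4 => ![zero, pos, neg, one] i) fun a => by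
    cases a
    · exact ⟨0, rfl⟩
    · exact ⟨1, rfl⟩
    · exact ⟨2, rfl⟩
    · exact ⟨3, rfl⟩

theorem lt_iff {a b : CovSign} : a < b ↔ (a = zero ∧ b ≠ zero) ∨ (a ≠ one ∧ b = one) := by
  rw [lt_iff_le_and_ne]
  change (a = b ∨ a = zero ∨ b = one) ∧ a ≠ b ↔ _
  cases a <;> cases b <;> simp

theorem star_zero_left (b : CovSign) : star zero b = b := by
  cases b <;> simp [star, lt_iff]

theorem star_eq_left {a b : CovSign} (ha : a ≠ zero) (hb : b ≠ one) : star a b = a := by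
  simp [star, lt_iff, ha, hb]

theorem star_eq_zero_iff {a b : CovSign} : star a b = zero ↔ a = zero ∧ b = zero := by
  cases a <;> cases b <;> simp [star, lt_iff]

end CovSign

namespace IntervalGreedoid

variable {E : Type*} [DecidableEq E] [Fintype E] {G : IntervalGreedoid E}

theorem comp_apply_of_mem_cont_top (α β : E → CovSign) {e : E} (he : e ∈ cont (⊤ : G.Flat)) :
    G.comp α β e = CovSign.star (α e) (β e) :=
  if_pos (cont_top_subset _ he)

theorem comp_eq_zero_of_mem_xi {α β : E → CovSign} (hα : α ∈ G.allCovectors)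
    (hβ : β ∈ G.allCovectors) {A : G.Flat} (h : G.supp α ≤ A) (h' : G.supp β ≤ A) {e : E}
    (he : e ∈ xi A) : G.comp α β e = CovSign.zero := by
  have hC : e ∈ xi (G.supp α ⊔ G.supp β) := xi_anti (sup_le h h') he
  have hC' : e ∈ cont (G.supp α ⊔ G.supp β) ∪ xi (G.supp α ⊔ G.supp β) := Or.inr hC
  rw [comp, if_pos hC', (supp_le_iff hα A).1 h e he, (supp_le_iff hβ A).1 h' e he,
    CovSign.star_zero_left]

end IntervalGreedoid

namespace OrientedIntervalGreedoid

open IntervalGreedoid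

variable {E : Type*} [DecidableEq E] [Fintype E] {G : IntervalGreedoid E}
  (O : OrientedIntervalGreedoid G)

variable {O} in
theorem supp_comp_le {α β : E → CovSign} (hα : α ∈ O.covectors) (hβ : β ∈ O.covectors)
    {A : G.Flat} (h : G.supp α ≤ A) (h' : G.supp β ≤ A) : G.supp (G.comp α β) ≤ A :=
  (supp_le_iff (O.subset_allCovectors (O.og3 α hα β hβ)) A).2 fun _ =>
    comp_eq_zero_of_mem_xi (O.subset_allCovectors hα) (O.subset_allCovectors hβ) h h'

/-! ### Topes -/

theorem mem_topes_iff {α : E → CovSign} : α ∈ O.topes ↔ α ∈ O.covectors ∧ G.supp α = ⊤ := by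
  constructor
  · rintro ⟨hα, hmax⟩
    refine ⟨hα, ?_⟩
    by_contra hne
    -- composing with a covector `τ` of support `⊤` gives a covector strictly above `α`
    obtain ⟨τ, hτ, hτs⟩ := O.og1 ⊤
    obtain ⟨e, he, hAe⟩ := exists_le_flatOf_singleton hne
    have hβ := O.og3 α hα τ hτ
    have hαe := (supp_le_flatOf_singleton (O.subset_allCovectors hα) he).1 hAe
    have heq : G.comp α τ = α := hmax _ hβ ⟨flatOf_anti fun i hi => ?_, fun i hi => ?_⟩
    · have h1 := congrFun heq e
      rw [comp_apply_of_mem_cont_top _ _ he, hαe, CovSign.star_zero_left] at h1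
      have h2 := (mem_cont_supp_iff (O.subset_allCovectors hτ) e).1 (hτs ▸ he)
      rcases h2 with h2 | h2 <;> simp [h2] at h1
    · rw [Set.mem_ofPred_eq, comp] at hi
      split_ifs at hi
      exact (CovSign.star_eq_zero_iff.1 hi).1
    · have h1 := (mem_cont_supp_iff (O.subset_allCovectors hα) i).1 hi.1
      have h2 := (mem_cont_supp_iff (O.subset_allCovectors hβ) i).1 hi.2
      rw [comp] at h2 ⊢
      split_ifs at h2 ⊢
      · revert h1 h2
        cases α i <;> cases τ i <;> simp [CovSign.star, CovSign.lt_iff]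
      · simp at h2
  · rintro ⟨hα, hs⟩
    refine ⟨hα, fun β hβ hle => ?_⟩
    have hβs : G.supp β = ⊤ := top_le_iff.1 (hs ▸ hle.1)
    refine (eq_of_eqOn_cont (O.subset_allCovectors hα) (O.subset_allCovectors hβ)
      (hs.trans hβs.symm) fun e he => hle.2 e ⟨he, ?_⟩).symm
    rwa [hβs, ← hs]

theorem supp_eq_top_iff {α : E → CovSign} (hα : α ∈ G.allCovectors) :
    G.supp α = ⊤ ↔ ∀ e ∈ cont (⊤ : G.Flat), α e ≠ CovSign.zero := by
  constructor
  · intro h e he h0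
    rw [← supp_le_flatOf_singleton hα he, h] at h0
    exact flatOf_singleton_ne_top he (top_le_iff.1 h0)
  · intro h
    by_contra hne
    obtain ⟨e, he, hle⟩ := exists_le_flatOf_singleton hne
    exact h e he ((supp_le_flatOf_singleton hα he).1 hle)

/-! ### Sign patterns of covectors and their deletion-contraction recursion -/

/-- The restriction of `v` to `J`, extended by `0`. -/
def restrictTo (J : Finset E) (v : E → CovSign) (e : E) : CovSign :=
  if e ∈ J then v e else CovSign.zero

omit [Fintype E] in
theorem restrictTo_insert (J : Finset E) (e : E) (v : E → CovSign) :
    restrictTo (insert e J) v = Function.update (restrictTo J v) e (v e) := by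
  ext i
  by_cases h : i = e
  · subst h
    simp [restrictTo]
  · simp [restrictTo, h]

omit [Fintype E] in
theorem restrictTo_eq_iff {J : Finset E} {v w : E → CovSign} :
    restrictTo J v = restrictTo J w ↔ ∀ e ∈ J, v e = w e := by
  constructor
  · intro h e he
    simpa [restrictTo, he] using congrFun h e
  · intro h
    ext e
    unfold restrictTo
    split_ifs with he
    · exact h e he
    · rfl

/-- The covectors in the contraction by `A` (those with support at most `A`) without zeros
on `J`. -/
def nonzeroOn (J : Finset E) (A : G.Flat) : Set (E → CovSign) :=
  {v | v ∈ O.covectors ∧ G.supp v ≤ A ∧ ∀ i ∈ J, v i ≠ CovSign.zero}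

/-- The sign patterns on `J` of the covectors that have support at most `A` and no zeros
on `J`. -/
def patterns (J : Finset E) (A : G.Flat) : Set (E → CovSign) :=
  restrictTo J '' O.nonzeroOn J A

theorem ncard_patterns_empty (A : G.Flat) : (O.patterns ∅ A).ncard = 1 := by
  obtain ⟨v, hv, hs⟩ := O.og1 A
  rw [Set.ncard_eq_one]
  refine ⟨restrictTo ∅ v, Set.eq_singleton_iff_unique_mem.2 ⟨⟨v, ⟨hv, hs.le, by simp⟩, rfl⟩, ?_⟩⟩
  rintro _ ⟨w, -, rfl⟩
  simp [restrictTo_eq_iff]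

theorem patterns_insert_of_le (J : Finset E) {e : E} (he : e ∈ cont (⊤ : G.Flat)) {A : G.Flat}
    (h : A ≤ G.flatOf {e}) : O.patterns (insert e J) A = ∅ := by
  rw [patterns, Set.image_eq_empty, Set.eq_empty_iff_forall_notMem]
  rintro v ⟨hv, hs, hJ⟩
  exact hJ e (Finset.mem_insert_self e J)
    ((supp_le_flatOf_singleton (O.subset_allCovectors hv) he).1 (hs.trans h))

/-- The patterns on `J` that extend to a covector with value `s` at `e`. -/
def patternsWith (J : Finset E) (A : G.Flat) (e : E) (s : CovSign) : Set (E → CovSign) :=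
  restrictTo J '' {v | v ∈ O.nonzeroOn J A ∧ v e = s}

theorem ncard_patterns_insert_eq_add {J : Finset E} {e : E} (he : e ∈ cont (⊤ : G.Flat))
    (heJ : e ∉ J) (A : G.Flat) :
    (O.patterns (insert e J) A).ncard =
      (O.patternsWith J A e .pos).ncard + (O.patternsWith J A e .neg).ncard := by
  have hunion : O.patterns (insert e J) A =
      (fun σ => Function.update σ e .pos) '' O.patternsWith J A e .pos ∪
        (fun σ => Function.update σ e .neg) '' O.patternsWith J A e .neg := by
    ext σ
    constructor
    · rintro ⟨v, ⟨hv, hs, hJ⟩, rfl⟩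
      have hn : v ∈ O.nonzeroOn J A := ⟨hv, hs, fun i hi => hJ i (Finset.mem_insert_of_mem hi)⟩
      have h0 := hJ e (Finset.mem_insert_self e J)
      have h1 := ne_one_of_mem_cont_top (O.subset_allCovectors hv) he
      rw [restrictTo_insert]
      cases hve : v e with
      | zero => exact absurd hve h0
      | one => exact absurd hve h1
      | pos => exact Or.inl ⟨_, ⟨v, ⟨hn, hve⟩, rfl⟩, rfl⟩
      | neg => exact Or.inr ⟨_, ⟨v, ⟨hn, hve⟩, rfl⟩, rfl⟩
    · rintro (⟨_, ⟨v, ⟨⟨hv, hs, hJ⟩, hve⟩, rfl⟩, rfl⟩ | ⟨_, ⟨v, ⟨⟨hv, hs, hJ⟩, hve⟩, rfl⟩, rfl⟩) <;>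
      · refine ⟨v, ⟨hv, hs, ?_⟩, by rw [restrictTo_insert, hve]⟩
        rw [Finset.forall_mem_insert]
        exact ⟨by simp [hve], hJ⟩
  have hinj : ∀ s t, Set.InjOn (fun σ : E → CovSign => Function.update σ e t)
      (O.patternsWith J A e s) := by
    rintro s t _ ⟨v, -, rfl⟩ _ ⟨w, -, rfl⟩ h
    rw [restrictTo_eq_iff]
    intro i hi
    have hie : i ≠ e := fun h => heJ (h ▸ hi)
    simpa [restrictTo, hie, hi] using congrFun h i
  have hdis : Disjoint ((fun σ => Function.update σ e .pos) '' O.patternsWith J A e .pos)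
      ((fun σ => Function.update σ e .neg) '' O.patternsWith J A e .neg) := by
    rw [Set.disjoint_left]
    rintro _ ⟨σ, -, rfl⟩ ⟨ρ, -, h⟩
    simpa using congrFun h e
  rw [hunion, Set.ncard_union_eq hdis, (hinj _ _).ncard_image, (hinj _ _).ncard_image]

variable {O} in
theorem comp_mem_nonzeroOn {J : Finset E} (hJ : (J : Set E) ⊆ cont (⊤ : G.Flat)) {A : G.Flat}
    {v w : E → CovSign} (hv : v ∈ O.nonzeroOn J A) (hw : w ∈ O.covectors)
    (hws : G.supp w ≤ A) :
    G.comp v w ∈ O.nonzeroOn J A ∧ restrictTo J (G.comp v w) = restrictTo J v := by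
  have key : ∀ i ∈ J, G.comp v w i = v i := fun i hi => by
    rw [comp_apply_of_mem_cont_top _ _ (hJ hi)]
    exact CovSign.star_eq_left (hv.2.2 i hi)
      (ne_one_of_mem_cont_top (O.subset_allCovectors hw) (hJ hi))
  refine ⟨⟨O.og3 v hv.1 w hw, supp_comp_le hv.1 hw hv.2.1 hws, fun i hi => ?_⟩,
    restrictTo_eq_iff.2 key⟩
  rw [key i hi]
  exact hv.2.2 i hi

theorem exists_apply_eq {e : E} (he : e ∈ cont (⊤ : G.Flat)) {A : G.Flat}
    (h : ¬ A ≤ G.flatOf {e}) {s : CovSign} (hs : s = .pos ∨ s = .neg) :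
    ∃ w ∈ O.covectors, G.supp w ≤ A ∧ w e = s := by
  obtain ⟨w, hw, hws⟩ := O.og1 A
  have hmem := O.subset_allCovectors hw
  have h0 : w e ≠ CovSign.zero := fun h' =>
    h (hws ▸ (supp_le_flatOf_singleton hmem he).2 h')
  have h1 := ne_one_of_mem_cont_top hmem he
  have hneg := O.og2 w hw
  have hnegs : G.supp (fun i => (w i).opp) ≤ A :=
    (supp_le_iff (O.subset_allCovectors hneg) A).2 fun i hi => by
      rw [(supp_le_iff hmem A).1 hws.le i hi]
      rfl
  by_cases hwe : w e = s
  · exact ⟨w, hw, hws.le, hwe⟩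
  · refine ⟨_, hneg, hnegs, ?_⟩
    revert h0 h1 hwe
    rcases hs with rfl | rfl <;> cases w e <;> simp [CovSign.opp]

theorem patternsWith_union {J : Finset E} (hJ : (J : Set E) ⊆ cont (⊤ : G.Flat)) {e : E}
    (he : e ∈ cont (⊤ : G.Flat)) {A : G.Flat} (h : ¬ A ≤ G.flatOf {e}) :
    O.patternsWith J A e .pos ∪ O.patternsWith J A e .neg = O.patterns J A := by
  apply Set.Subset.antisymm
  · rintro _ (⟨v, ⟨hv, -⟩, rfl⟩ | ⟨v, ⟨hv, -⟩, rfl⟩) <;> exact ⟨v, hv, rfl⟩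
  · rintro _ ⟨v, hv, rfl⟩
    cases hve : v e with
    | pos => exact Or.inl ⟨v, ⟨hv, hve⟩, rfl⟩
    | neg => exact Or.inr ⟨v, ⟨hv, hve⟩, rfl⟩
    | one => exact absurd hve (ne_one_of_mem_cont_top (O.subset_allCovectors hv.1) he)
    | zero =>
      obtain ⟨w, hw, hws, hwe⟩ := O.exists_apply_eq he h (Or.inl rfl)
      obtain ⟨h1, h2⟩ := comp_mem_nonzeroOn hJ hv hw hws
      refine Or.inl ⟨_, ⟨h1, ?_⟩, h2⟩
      rw [comp_apply_of_mem_cont_top _ _ he, hve, CovSign.star_zero_left, hwe]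

/-- A pattern that extends with both signs at `e` also extends by `0` at `e`, by covector
elimination, and a pattern that extends by `0` extends with both signs, by composition. -/
theorem patternsWith_inter {J : Finset E} (hJ : (J : Set E) ⊆ cont (⊤ : G.Flat)) {e : E}
    (he : e ∈ cont (⊤ : G.Flat)) {A : G.Flat} (h : ¬ A ≤ G.flatOf {e}) :
    O.patternsWith J A e .pos ∩ O.patternsWith J A e .neg = O.patterns J (A ⊓ G.flatOf {e}) := by
  apply Set.Subset.antisymm
  · rintro _ ⟨⟨v, ⟨hv, hve⟩, rfl⟩, ⟨w, ⟨hw, hwe⟩, hwv⟩⟩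
    rw [restrictTo_eq_iff] at hwv
    have hvm := O.subset_allCovectors hv.1
    have hwm := O.subset_allCovectors hw.1
    obtain ⟨γ, hγ, hγe, hγy⟩ := O.og4 v hv.1 w hw.1 e
      (by simp [separationSet, hve, hwe, CovSign.opp])
      (ne_one_of_mem_cont_top (O.subset_allCovectors (O.og3 v hv.1 w hw.1)) he)
    have hγm := O.subset_allCovectors hγ
    have key : ∀ i ∈ J, γ i = v i := fun i hi => by
      have h0 := hv.2.2 i hi
      have h1 := ne_one_of_mem_cont_top hvm (hJ hi)
      have hc : G.comp v w i = v i := by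
        rw [comp_apply_of_mem_cont_top _ _ (hJ hi), hwv i hi, CovSign.star_eq_left h0 h1]
      rw [← hc]
      refine (hγy i ?_ (hc ▸ h1)).1
      rw [separationSet, Set.mem_ofPred_eq, hwv i hi]
      cases v i <;> simp [CovSign.opp]
    have hγA : G.supp γ ≤ A := (supp_le_iff hγm A).2 fun i hi => by
      have hc := comp_eq_zero_of_mem_xi hvm hwm hv.2.1 hw.2.1 hi
      rw [← hc]
      refine (hγy i ?_ (by simp [hc])).1
      simp [separationSet, (supp_le_iff hvm A).1 hv.2.1 i hi]
    refine ⟨γ, ⟨hγ, le_inf hγA ((supp_le_flatOf_singleton hγm he).2 hγe), fun i hi => ?_⟩,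
      restrictTo_eq_iff.2 key⟩
    rw [key i hi]
    exact hv.2.2 i hi
  · rintro _ ⟨v, ⟨hv, hvs, hv0⟩, rfl⟩
    have hve := (supp_le_flatOf_singleton (O.subset_allCovectors hv) he).1 (hvs.trans inf_le_right)
    have hvA : v ∈ O.nonzeroOn J A := ⟨hv, hvs.trans inf_le_left, hv0⟩
    have key : ∀ s, s = .pos ∨ s = .neg → restrictTo J v ∈ O.patternsWith J A e s := fun s hs => by
      obtain ⟨w, hw, hws, hwe⟩ := O.exists_apply_eq he h hs
      obtain ⟨h1, h2⟩ := comp_mem_nonzeroOn hJ hvA hw hws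
      refine ⟨_, ⟨h1, ?_⟩, h2⟩
      rw [comp_apply_of_mem_cont_top _ _ he, hve, CovSign.star_zero_left, hwe]
    exact ⟨key _ (Or.inl rfl), key _ (Or.inr rfl)⟩

theorem ncard_patterns_insert {J : Finset E} (hJ : (J : Set E) ⊆ cont (⊤ : G.Flat)) {e : E}
    (he : e ∈ cont (⊤ : G.Flat)) (heJ : e ∉ J) {A : G.Flat} (h : ¬ A ≤ G.flatOf {e}) :
    (O.patterns (insert e J) A).ncard =
      (O.patterns J A).ncard + (O.patterns J (A ⊓ G.flatOf {e})).ncard := by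
  rw [O.ncard_patterns_insert_eq_add he heJ, ← O.patternsWith_union hJ he h,
    ← O.patternsWith_inter hJ he h, Set.ncard_union_add_ncard_inter]

/-- A tope is determined by its pattern on the continuations of the empty set. -/
theorem ncard_topes_eq_ncard_patterns {I : Finset E} (hI : (I : Set E) = cont (⊤ : G.Flat)) :
    O.topes.ncard = (O.patterns I ⊤).ncard := by
  have hmem : ∀ e, e ∈ I ↔ e ∈ cont (⊤ : G.Flat) := fun e => by rw [← hI, Finset.mem_coe]
  have htopes : O.nonzeroOn I ⊤ = O.topes := by
    ext v
    rw [mem_topes_iff]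
    refine and_congr_right fun hv => ?_
    rw [supp_eq_top_iff (O.subset_allCovectors hv)]
    simp [hmem]
  rw [patterns, htopes]
  refine (Set.InjOn.ncard_image fun v hv w hw h => ?_).symm
  rw [mem_topes_iff] at hv hw
  refine eq_of_eqOn_cont (O.subset_allCovectors hv.1) (O.subset_allCovectors hw.1)
    (hv.2.trans hw.2.symm) fun e he => restrictTo_eq_iff.1 h e ?_
  rwa [hmem, ← hv.2]

end OrientedIntervalGreedoid

/-! ### The number of topes -/

theorem mainTheorem5 {E : Type*} [DecidableEq E] [Fintype E] (G : IntervalGreedoid E)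
    (O : OrientedIntervalGreedoid G) :
    (O.topes.ncard : ℤ) = ∑ B : G.Flat, |IncidenceAlgebra.mu ℤ B ⊤| := by
  classical
  set I : Finset E := (IntervalGreedoid.cont (⊤ : G.Flat)).toFinset
  have hmem : ∀ e, e ∈ I ↔ e ∈ IntervalGreedoid.cont (⊤ : G.Flat) := fun e => Set.mem_toFinset
  rw [O.ncard_topes_eq_ncard_patterns (I := I) (Set.coe_toFinset _),
    eq_sum_abs_altSum (fun e => G.flatOf {e}) (r := IntervalGreedoid.rank) (I := I)
      (N := fun J A => (O.patterns J A).ncard)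
      (fun e he A => IntervalGreedoid.rank_inf_flatOf_singleton ((hmem e).1 he) A)
      O.ncard_patterns_empty
      (fun J e he A h => by simp [O.patterns_insert_of_le J ((hmem e).1 he) h])
      (fun J hJ e he heJ A h => O.ncard_patterns_insert (fun i hi => (hmem i).1 (hJ hi))
        ((hmem e).1 he) heJ h) subset_rfl]
  refine Finset.sum_congr rfl fun B _ => ?_
  rw [altSum_top_eq_mu _ (fun e he => IntervalGreedoid.flatOf_singleton_ne_top ((hmem e).1 he))]
  intro B hB
  obtain ⟨e, he, hle⟩ := IntervalGreedoid.exists_le_flatOf_singleton hB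
  exact ⟨e, (hmem e).2 he, hle⟩
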